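/- Let $k$ be a field, let $d \ge 0$ be an integer, and let $A = k[X_1,\dots,X_d]$. Let $K^b(\operatorname{proj} A)$ be the homotopy category of bounded complexes of finitely generated projective $A$-modules, with its usual triangulated structure. Let $\mathcal{C}$ be its full subcategory of complexes $X$ such that $H^*(X) = \bigoplus_n H^n(X)$ has finite length, and for each maximal ideal $\mathfrak{m}$ of $A$ let $\mathcal{C}_{\mathfrak{m}}$ be the full subcategory of those $X \in \mathcal{C}$ with $\operatorname{Supp} H^*(X) \subseteq \{\mathfrak{m}\}$. For a triangulated category $\mathcal{T}$ and full triangulated subcategories $\mathcal{T}_i$, closed under isomorphism, write $\mathcal{T} = \bigoplus_i \mathcal{T}_i$ if every object of $\mathcal{T}$ is isomorphic to a finite direct sum of objects of the $\mathcal{T}_i$, if $\operatorname{Hom}(X,Y)=0$ for $X \in \mathcal{T}_i$, $Y \in \mathcal{T}_j$, $i \neq j$, and if a finite direct sum of triangles in distinct $\mathcal{T}_i$ is distinguished exactly when each of them is. Call $\mathcal{T}$ connected if $\mathcal{T} \ne 0$ and $\mathcal{T} = \mathcal{T}_1 \oplus \mathcal{T}_2$ implies $\mathcal{T}_1 = 0$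 or $\mathcal{T}_2 = 0$. A thick subcategory is a full triangulated subcategory closed under direct summands. Then: 1. $\mathcal{C}$ and all $\mathcal{C}_{\mathfrak{m}}$ are thick subcategories of $K^b(\operatorname{proj} A)$, and $\mathcal{C}$ is the smallest thick subcategory of $K^b(\operatorname{proj} A)$ containing all $\mathcal{C}_{\mathfrak{m}}$; 2. $\mathcal{C} = \bigoplus_{\mathfrak{m}} \mathcal{C}_{\mathfrak{m}}$, the direct sum over all maximal ideals $\mathfrak{m}$ of $A$; 3. each $\mathcal{C}_{\mathfrak{m}}$ is connected (in particular nonzero), and $\mathcal{C}_{\mathfrak{m}} \neq \mathcal{C}_{\mathfrak{n}}$ for $\mathfrak{m} \neq \mathfrak{n}$; 4. if $d \ge 1$, then $A$ has infinitely many maximal ideals. Thus, for $d \ge 1$, $\mathcal{C}$ is a triangulated category that decomposes into infinitely many connected components. -/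

import Mathlib

open CategoryTheory Limits Pretriangulated ZeroObject

universe u v w

noncomputable section

/-! ### Subcategories of a triangulated category

A full subcategory is given by the property of objects that defines it. -/

section Triangulated

variable {T : Type u} [Category.{v} T] [HasZeroObject T] [HasShift T ℤ] [Preadditive T]
  [∀ n : ℤ, (shiftFunctor T n).Additive] [Pretriangulated T]

/-- `Q` is a thick subcategory of the triangulated category `T`: a full triangulated subcategory
that contains all direct summands (in `T`) of its objects. In particular it is closed under
isomorphisms. -/
structure IsThick (Q : ObjectProperty T) : Prop where
  isTriangulated : Q.IsTriangulated
  isStableUnderRetracts : Q.IsStableUnderRetracts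

/-- The full subcategory `Q` of `T` is the direct sum, as a triangulated category, of the
family `P` of full triangulated subcategories: its objects are the finite direct sums
of objects of the `P i`, there are no nonzero morphisms between different summands (so that
`Hom (⨁ X i) (⨁ Y i)` is the direct sum of the `Hom (X i) (Y i)`), and a direct sum of
triangles in the summands is distinguished if and only if each of them is. -/
structure IsTriangulatedDirectSum {ι : Type w} (Q : ObjectProperty T)
    (P : ι → ObjectProperty T) : Prop where
  isTriangulated (i : ι) : (P i).IsTriangulated
  isClosedUnderIsomorphisms (i : ι) : (P i).IsClosedUnderIsomorphisms
  prop_iff (X : T) : Q X ↔ ∃ (s : Finset ι) (Y : s → T),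
    (∀ i : s, P i (Y i)) ∧ Nonempty (X ≅ ⨁ Y)
  hom_eq_zero {i j : ι} (_ : i ≠ j) {X Y : T} (_ : P i X) (_ : P j Y) (f : X ⟶ Y) : f = 0
  distinguished_iff (s : Finset ι) (t : s → Triangle T)
    (_ : ∀ i : s, P i (t i).obj₁ ∧ P i (t i).obj₂ ∧ P i (t i).obj₃) :
    productTriangle t ∈ distTriang T ↔ ∀ i : s, t i ∈ distTriang T

/-- The triangulated subcategory `Q` of `T` is connected: it is nonzero, and if it is the direct
sum of two triangulated categories, then one of them is zero. -/
structure IsConnectedTriangulated (Q : ObjectProperty T) : Prop where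
  ne_zero : ∃ X : T, Q X ∧ ¬ IsZero X
  eq_zero_or_eq_zero (P₁ P₂ : ObjectProperty T) (_ : IsTriangulatedDirectSum Q ![P₁, P₂]) :
    (∀ X : T, P₁ X → IsZero X) ∨ (∀ X : T, P₂ X → IsZero X)

end Triangulated

/-! ### The category `K^b(proj A)` -/

section Kb

variable (A : Type u) [CommRing A]

/-- Bounded cochain complexes of finitely generated projective `A`-modules. -/
structure IsBoundedProj (K : CochainComplex (ModuleCat.{u} A) ℤ) : Prop where
  finite (n : ℤ) : Module.Finite A (K.X n)
  projective (n : ℤ) : Module.Projective A (K.X n)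
  bounded : ∃ a b : ℤ, K.IsStrictlyGE a ∧ K.IsStrictlyLE b

/-- The objects of the homotopy category of complexes of `A`-modules that are bounded complexes
of finitely generated projective `A`-modules. -/
def kbProj : ObjectProperty (HomotopyCategory (ModuleCat.{u} A) (ComplexShape.up ℤ)) :=
  fun K => IsBoundedProj A K.as

variable {A}

lemma isBoundedProj_mappingCone {K L : CochainComplex (ModuleCat.{u} A) ℤ} (f : K ⟶ L)
    (hK : IsBoundedProj A K) (hL : IsBoundedProj A L) :
    IsBoundedProj A (CochainComplex.mappingCone f) := by
  have e (n : ℤ) : (CochainComplex.mappingCone f).X n ≃ₗ[A] (K.X (n + 1) × L.X n) :=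
    (HomologicalComplex.homotopyCofiber.XIsoBiprod f n (n + 1) rfl ≪≫
      ModuleCat.biprodIsoProd _ _).toLinearEquiv
  refine ⟨fun n => ?_, fun n => ?_, ?_⟩
  · have := hK.finite (n + 1)
    have := hL.finite n
    exact Module.Finite.equiv (e n).symm
  · have := hK.projective (n + 1)
    have := hL.projective n
    exact Module.Projective.of_equiv (e n).symm
  · obtain ⟨a, b, _, _⟩ := hK.bounded
    obtain ⟨a', b', _, _⟩ := hL.bounded
    refine ⟨min (a - 1) a', max b b', ?_, ?_⟩
    · exact CochainComplex.isStrictlyGE_mappingCone f a a' _ (by grind) (by grind)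
    · rw [CochainComplex.isStrictlyLE_iff]
      intro i hi
      rw [CochainComplex.mappingCone.isZero_X_iff]
      exact ⟨K.isZero_of_isStrictlyLE b _ (by grind), L.isZero_of_isStrictlyLE b' _ (by grind)⟩

lemma isBoundedProj_zero : IsBoundedProj A (0 : CochainComplex (ModuleCat.{u} A) ℤ) := by
  have h (n : ℤ) : Subsingleton ((0 : CochainComplex (ModuleCat.{u} A) ℤ).X n) :=
    ModuleCat.subsingleton_of_isZero ((HomologicalComplex.eval _ _ n).map_isZero (isZero_zero _))
  exact ⟨fun n => have := h n; inferInstance, fun n => have := h n; inferInstance,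
    0, 0, inferInstance, inferInstance⟩

instance : (kbProj A).ContainsZero where
  exists_zero := ⟨(HomotopyCategory.quotient _ _).obj 0,
    Functor.map_isZero _ (isZero_zero _), isBoundedProj_zero⟩

instance : (kbProj A).IsStableUnderShift ℤ where
  isStableUnderShiftBy n :=
    { le_shift K hK := by
        obtain ⟨K, rfl⟩ := K.quotient_obj_surjective
        have hK : IsBoundedProj A K := hK
        obtain ⟨a, b, _, _⟩ := hK.bounded
        rw [ObjectProperty.prop_shift_iff, HomotopyCategory.shift_quotient_obj]
        exact ⟨fun i => hK.finite (i + n), fun i => hK.projective (i + n), a - n, b - n,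
          CochainComplex.isStrictlyGE_shift K a n (a - n) (by lia), CochainComplex.isStrictlyLE_shift K b n (b - n) (by lia)⟩ }

instance : (kbProj A).IsTriangulatedClosed₃ where
  ext₃' t ht h₁ h₂ := by
    obtain ⟨f : t.obj₁.as ⟶ t.obj₂.as, hf⟩ :=
      (HomotopyCategory.quotient _ _).map_surjective t.mor₁
    exact ⟨_, isBoundedProj_mappingCone f h₁ h₂,
      ⟨Triangle.π₃.mapIso (isoTriangleOfIso₁₂ t _ ht
        (HomotopyCategory.mappingCone_triangleh_distinguished f)
        (Iso.refl _) (Iso.refl _)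
        ((Category.comp_id _).trans (hf.symm.trans (Category.id_comp _).symm)))⟩⟩

instance : (kbProj A).IsTriangulated where
  toIsTriangulatedClosed₂ := .of_isTriangulatedClosed₃

variable (A)

/-- `K^b(proj A)`, the homotopy category of bounded complexes of finitely generated projective
`A`-modules, with the triangulated structure of the homotopy category. -/
abbrev KbProj := (kbProj A).FullSubcategory

variable {A}

/-- The cohomology module `H^n(X)`. -/
abbrev KbProj.cohomology (X : KbProj A) (n : ℤ) : ModuleCat.{u} A :=
  (HomotopyCategory.homologyFunctor (ModuleCat.{u} A) (ComplexShape.up ℤ) n).obj X.obj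

variable (A)

/-- The complexes `X` in `K^b(proj A)` such that `H^*(X)` has finite length. As `X` is bounded,
only finitely many `H^n(X)` are nonzero, so this means that each of them has finite length. -/
def kbProjFiniteLength : ObjectProperty (KbProj A) :=
  fun X => ∀ n : ℤ, IsFiniteLength A (X.cohomology n)

variable {A}

/-- The complexes `X` in `K^b(proj A)` such that `H^*(X)` has finite length and its support, the
union of the supports of the `H^n(X)`, is contained in `{m}`. -/
def kbProjSupportedAt (m : MaximalSpectrum A) : ObjectProperty (KbProj A) :=
  fun X => kbProjFiniteLength A X ∧
    (⋃ n : ℤ, Module.support A (X.cohomology n)) ⊆ {m.toPrimeSpectrum}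

end Kb

end

/-! Write `P` for a complex in `K^b(proj A)` that resolves `A ⧸ m`. Every maximal ideal of a
polynomial ring over a field is generated by a regular sequence, so an iterated cone (the Koszul
complex) provides such a `P` for each `m`. Everything else follows formally from these complexes.

Dévissage (`kbProjSupportedIn_le`): a triangulated subcategory containing resolutions of `A ⧸ m` for
all maximal `m` in `S` contains every complex whose cohomology has finite length and support in `S`.
Indeed, a simple submodule `A ⧸ m` of the lowest cohomology module of `X` lifts to a morphism `P ⟶
X`, because `Hom(P, X)` is `Hom(A ⧸ m, H^0(X))` when `X` has no negative cohomology. The cone has a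
shorter `H^0` and no cohomology in new degrees.

Orthogonality: `Hom(P, P'⟦n⟧)` is killed by both `m` and `m'`, hence vanishes for `m ≠ m'`;
dévissage in each variable extends this to the whole subcategories. Finite sums of orthogonal
triangulated subcategories form a triangulated subcategory, and dévissage shows that it is
everything.

Connectedness: nonzero endomorphisms of `P` are invertible, so `P` lies in one summand of any
decomposition. The other summand is then orthogonal to `P`, hence to all complexes supported at `m`,
including its own objects. -/

noncomputable section

/-! ### Finite direct sums of orthogonal triangulated subcategories -/

section FiniteSums

variable {T : Type u} [Category.{v} T] [HasZeroObject T] [HasShift T ℤ] [Preadditive T]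
  [∀ n : ℤ, (shiftFunctor T n).Additive] [Pretriangulated T]
variable {ι : Type w} (P : ι → ObjectProperty T)

/-- The finite direct sums of objects of the `P i`, for distinct `i`. -/
def finiteSums : ObjectProperty T := fun X =>
  ∃ (s : Finset ι) (Y : s → T), (∀ i : s, P i (Y i)) ∧ Nonempty (X ≅ ⨁ Y)

instance : (finiteSums P).IsClosedUnderIsomorphisms where
  of_iso := by
    rintro X X' e ⟨s, Y, hY, ⟨e'⟩⟩
    exact ⟨s, Y, hY, ⟨e.symm ≪≫ e'⟩⟩

/-- The morphisms between objects of different members of the family vanish. -/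
def IsOrthogonalFamily : Prop :=
  ∀ ⦃i j : ι⦄, i ≠ j → ∀ ⦃X Y : T⦄, P i X → P j Y → ∀ f : X ⟶ Y, f = 0

variable {P}

lemma le_finiteSums (i : ι) : P i ≤ finiteSums P := fun X hX =>
  ⟨{i}, fun _ => X, fun ⟨j, hj⟩ => by
    obtain rfl : j = i := by simpa using hj
    exact hX, ⟨(biproductUniqueIso (fun _ : ({i} : Finset ι) => X)).symm⟩⟩

/-- Enlarging the index set of a direct sum by zero objects. -/
def biproductIsoOfSubset {s s' : Finset ι} (hs : s ⊆ s') (Y : ι → T)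
    (hY : ∀ i ∉ s, IsZero (Y i)) :
    (⨁ fun i : s => Y i) ≅ ⨁ fun i : s' => Y i where
  hom := biproduct.desc fun i => biproduct.ι (fun i : s' => Y i) ⟨i, hs i.2⟩
  inv := biproduct.lift fun i => biproduct.π (fun i : s' => Y i) ⟨i, hs i.2⟩
  hom_inv_id := by
    classical
    ext j i
    by_cases h : i = j
    · subst h; simp
    · rw [Category.id_comp, biproduct.ι_π_ne _ h, Category.assoc, biproduct.ι_desc_assoc,
        biproduct.lift_π, biproduct.ι_π_ne]
      exact fun h' => h (Subtype.ext (Subtype.mk.inj h'))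
  inv_hom_id := by
    classical
    refine biproduct.hom_ext' _ _ fun ⟨i, hi⟩ => ?_
    by_cases h : i ∈ s
    · have : biproduct.ι (fun i : s' => Y i) ⟨i, hi⟩ ≫
          (biproduct.lift fun i : s => biproduct.π (fun i : s' => Y i) ⟨i, hs i.2⟩) =
          biproduct.ι (fun i : s => Y i) ⟨i, h⟩ := by
        ext j
        by_cases hj : (⟨i, h⟩ : s) = j
        · subst hj; simp
        · rw [Category.assoc, biproduct.lift_π, biproduct.ι_π_ne _ hj, biproduct.ι_π_ne]
          exact fun h' => hj (Subtype.ext (Subtype.mk.inj h'))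
      rw [reassoc_of% this]
      simp
    · exact (hY i h).eq_of_src _ _

/-- Zero summands may be added, so that the source and target of a morphism can be indexed by the
same finite set. -/
lemma exists_finset_iso_biproduct_of_subset {X : T} (h0 : ∀ i, (P i).ContainsZero)
    (hiso : ∀ i, (P i).IsClosedUnderIsomorphisms) (hX : finiteSums P X) :
    ∃ s : Finset ι, ∀ s', s ⊆ s' → ∃ Y : ι → T, (∀ i, P i (Y i)) ∧
      Nonempty (X ≅ ⨁ fun i : s' => Y i) := by
  classical
  obtain ⟨s, Y, hY, ⟨e⟩⟩ := hX
  refine ⟨s, fun s' hs => ?_⟩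
  let Y' : ι → T := fun i => if h : i ∈ s then Y ⟨i, h⟩ else 0
  refine ⟨Y', fun i => ?_, ⟨e ≪≫ biproduct.mapIso (fun i => eqToIso (by simp [Y'])) ≪≫
    biproductIsoOfSubset hs Y' fun i hi => ?_⟩⟩
  · by_cases h : i ∈ s
    · simpa [Y', h] using hY ⟨i, h⟩
    · simpa [Y', h] using (P i).prop_zero
  · simpa [Y', hi] using isZero_zero T

/-- The off-diagonal matrix entries vanish by orthogonality. -/
lemma IsOrthogonalFamily.biproduct_hom_eq_map (hP : IsOrthogonalFamily P) {s : Finset ι}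
    {Y Z : s → T} (hY : ∀ i : s, P i (Y i)) (hZ : ∀ i : s, P i (Z i)) (f : ⨁ Y ⟶ ⨁ Z) :
    f = biproduct.map fun i => biproduct.ι Y i ≫ f ≫ biproduct.π Z i := by
  classical
  refine biproduct.hom_ext' _ _ fun j => biproduct.hom_ext _ _ fun k => ?_
  rw [Category.assoc, Category.assoc]
  by_cases h : j = k
  · subst h; simp
  · rw [hP (fun h' => h (Subtype.ext h')) (hY j) (hZ k) (biproduct.ι Y j ≫ f ≫ biproduct.π Z k)]
    simp [h]

lemma isStableUnderShift_finiteSums (h : ∀ i, (P i).IsStableUnderShift ℤ) :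
    (finiteSums P).IsStableUnderShift ℤ where
  isStableUnderShiftBy n :=
    { le_shift := by
        rintro X ⟨s, Y, hY, ⟨e⟩⟩
        exact ⟨s, fun i => (Y i)⟦n⟧, fun i => (P i).le_shift n _ (hY i),
          ⟨(shiftFunctor T n).mapIso (e ≪≫ biproduct.isoProduct Y) ≪≫
            PreservesProduct.iso (shiftFunctor T n) Y ≪≫ (biproduct.isoProduct _).symm⟩⟩ }

/-- A morphism between two such sums is diagonal, so its cone is the sum of the cones of its
entries, each taken inside one `P i`. -/
lemma IsOrthogonalFamily.isTriangulatedClosed₃_finiteSums (hP : IsOrthogonalFamily P)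
    (htri : ∀ i, (P i).IsTriangulated) (hiso : ∀ i, (P i).IsClosedUnderIsomorphisms) :
    (finiteSums P).IsTriangulatedClosed₃ :=
  .mk' fun t ht h₁ h₂ => by
    classical
    obtain ⟨s₁, hs₁⟩ := exists_finset_iso_biproduct_of_subset (fun i => inferInstance) hiso h₁
    obtain ⟨s₂, hs₂⟩ := exists_finset_iso_biproduct_of_subset (fun i => inferInstance) hiso h₂
    obtain ⟨Y₁, hY₁, ⟨e₁⟩⟩ := hs₁ (s₁ ∪ s₂) Finset.subset_union_left
    obtain ⟨Y₂, hY₂, ⟨e₂⟩⟩ := hs₂ (s₁ ∪ s₂) Finset.subset_union_right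
    let Z₁ : (s₁ ∪ s₂ : Finset ι) → T := fun i => Y₁ i
    let Z₂ : (s₁ ∪ s₂ : Finset ι) → T := fun i => Y₂ i
    let e₁' : t.obj₁ ≅ ⨁ Z₁ := e₁
    let e₂' : t.obj₂ ≅ ⨁ Z₂ := e₂
    obtain ⟨f, hf'⟩ : ∃ f : ⨁ Z₁ ⟶ ⨁ Z₂, t.mor₁ ≫ e₂'.hom = e₁'.hom ≫ f :=
      ⟨e₁'.inv ≫ t.mor₁ ≫ e₂'.hom, by simp⟩
    have hf : f = biproduct.map fun i => biproduct.ι Z₁ i ≫ f ≫ biproduct.π Z₂ i :=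
      hP.biproduct_hom_eq_map (fun i => hY₁ i) (fun i => hY₂ i) f
    choose C hC b c hbc using fun i : (s₁ ∪ s₂ : Finset ι) =>
      (P i).distinguished_cocone_triangle (biproduct.ι Z₁ i ≫ f ≫ biproduct.π Z₂ i)
        (hY₁ i) (hY₂ i)
    have comm : t.mor₁ ≫ e₂'.hom ≫ (biproduct.isoProduct Z₂).hom =
        (e₁'.hom ≫ (biproduct.isoProduct Z₁).hom) ≫
          Limits.Pi.map fun i => biproduct.ι Z₁ i ≫ f ≫ biproduct.π Z₂ i := by
      have h : f ≫ (biproduct.isoProduct Z₂).hom = (biproduct.isoProduct Z₁).hom ≫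
          Limits.Pi.map fun i => biproduct.ι Z₁ i ≫ f ≫ biproduct.π Z₂ i := by
        refine Limits.Pi.hom_ext _ _ fun i => ?_
        rw [Category.assoc, Category.assoc, Limits.Pi.map_π, biproduct.isoProduct_hom,
          biproduct.isoProduct_hom, Pi.lift_π, Pi.lift_π_assoc]
        conv_lhs => rw [hf, biproduct.map_π]
      rw [reassoc_of% hf', Category.assoc, h]
    exact ⟨s₁ ∪ s₂, C, hC, ⟨Triangle.π₃.mapIso (isoTriangleOfIso₁₂ t _ ht
      (productTriangle_distinguished _ hbc) (e₁' ≪≫ biproduct.isoProduct Z₁)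
      (e₂' ≪≫ biproduct.isoProduct Z₂) comm) ≪≫ (biproduct.isoProduct C).symm⟩⟩

lemma IsOrthogonalFamily.isTriangulated_finiteSums (hP : IsOrthogonalFamily P)
    (htri : ∀ i, (P i).IsTriangulated) (hiso : ∀ i, (P i).IsClosedUnderIsomorphisms) :
    (finiteSums P).IsTriangulated where
  exists_zero := ⟨0, isZero_zero T, ∅, fun _ => 0, fun i => absurd i.2 (Finset.notMem_empty _),
    ⟨(isZero_zero T).iso ((IsZero.iff_id_eq_zero _).2
      (biproduct.hom_ext _ _ fun i => absurd i.2 (Finset.notMem_empty _)))⟩⟩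
  toIsStableUnderShift := isStableUnderShift_finiteSums fun _ => inferInstance
  toIsTriangulatedClosed₂ :=
    have := hP.isTriangulatedClosed₃_finiteSums htri hiso
    have := isStableUnderShift_finiteSums fun i => (htri i).toIsStableUnderShift
    .of_isTriangulatedClosed₃

/-- A direct sum of triangles in the members of an orthogonal family is distinguished if and only if
each of them is. -/
theorem IsOrthogonalFamily.productTriangle_distinguished_iff (hP : IsOrthogonalFamily P)
    (htri : ∀ i, (P i).IsTriangulated) (s : Finset ι) (t : s → Triangle T)
    (ht : ∀ i : s, P i (t i).obj₁ ∧ P i (t i).obj₂ ∧ P i (t i).obj₃) :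
    productTriangle t ∈ distTriang T ↔ ∀ i : s, t i ∈ distTriang T := by
  classical
  refine ⟨fun h i => ?_, fun h => productTriangle_distinguished t h⟩
  -- Replace each third vertex by a cone taken in `P i`. The product of the new triangles is
  -- isomorphic to the given product, and by orthogonality this isomorphism restricts to each
  -- factor.
  choose C hC b c hbc using fun i : s =>
    (P i).distinguished_cocone_triangle (t i).mor₁ (ht i).1 (ht i).2.1
  let t' : s → Triangle T := fun i => Triangle.mk (t i).mor₁ (b i) (c i)
  have ht' (i : s) : P i (t' i).obj₁ ∧ P i (t' i).obj₂ ∧ P i (t' i).obj₃ :=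
    ⟨(ht i).1, (ht i).2.1, hC i⟩
  let e : productTriangle t ≅ productTriangle t' :=
    isoTriangleOfIso₁₂ _ _ h (productTriangle_distinguished t' hbc) (Iso.refl _) (Iso.refl _)
      ((Category.comp_id _).trans (Category.id_comp _).symm)
  let inc (t : s → Triangle T) : t i ⟶ productTriangle t :=
    productTriangle.lift t fun j => if h : i = j then eqToHom (by rw [h]) else 0
  have inc_π (t : s → Triangle T) : inc t ≫ productTriangle.π t i = 𝟙 _ :=
    (Fan.IsLimit.fac (productTriangle.isLimitFan t)
      (fun j => if h : i = j then eqToHom (by rw [h]) else 0) i).trans (by simp)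
  -- A morphism from the `i`-th triangle into the product factors through the `i`-th factor: its
  -- other components vanish.
  have key {t₁ t₂ : s → Triangle T}
      (ht₁ : ∀ i : s, P i (t₁ i).obj₁ ∧ P i (t₁ i).obj₂ ∧ P i (t₁ i).obj₃)
      (ht₂ : ∀ i : s, P i (t₂ i).obj₁ ∧ P i (t₂ i).obj₂ ∧ P i (t₂ i).obj₃)
      (φ : t₁ i ⟶ productTriangle t₂) : φ ≫ productTriangle.π t₂ i ≫ inc t₂ = φ := by
    refine Fan.IsLimit.hom_ext (productTriangle.isLimitFan t₂) _ _ fun j => ?_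
    change (φ ≫ productTriangle.π t₂ i ≫ inc t₂) ≫ productTriangle.π t₂ j =
      φ ≫ productTriangle.π t₂ j
    by_cases h : i = j
    · subst h
      rw [Category.assoc, Category.assoc, inc_π, Category.comp_id]
    · have hij : (i : ι) ≠ j := fun h' => h (Subtype.ext h')
      ext
      · rw [hP hij (ht₁ i).1 (ht₂ j).1 (φ ≫ productTriangle.π t₂ j).hom₁]
        exact hP hij (ht₁ i).1 (ht₂ j).1 _
      · rw [hP hij (ht₁ i).2.1 (ht₂ j).2.1 (φ ≫ productTriangle.π t₂ j).hom₂]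
        exact hP hij (ht₁ i).2.1 (ht₂ j).2.1 _
      · rw [hP hij (ht₁ i).2.2 (ht₂ j).2.2 (φ ≫ productTriangle.π t₂ j).hom₃]
        exact hP hij (ht₁ i).2.2 (ht₂ j).2.2 _
  refine isomorphic_distinguished _ (hbc i) _
    ⟨inc t ≫ e.hom ≫ productTriangle.π t' i, inc t' ≫ e.inv ≫ productTriangle.π t i, ?_, ?_⟩
  · have := key ht ht' (inc t ≫ e.hom)
    simp only [Category.assoc] at this ⊢
    rw [reassoc_of% this, e.hom_inv_id_assoc, inc_π]
  · have := key ht' ht (inc t' ≫ e.inv)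
    simp only [Category.assoc] at this ⊢
    rw [reassoc_of% this, e.inv_hom_id_assoc, inc_π]

end FiniteSums

/-! ### Morphisms in the derived category detected by `H^0` -/

section HomologyInDegreeZero

variable {C : Type u} [Category.{v} C] [Abelian C] [HasDerivedCategory.{w} C]

open DerivedCategory in
/-- Morphisms from a complex with cohomology in degree zero only to a complex with cohomology in
nonnegative degrees are detected by the cohomology in degree zero. -/
theorem DerivedCategory.homologyFunctor_zero_map_bijective (X Y : DerivedCategory C) [X.IsLE 0]
    [X.IsGE 0] [Y.IsGE 0] :
    Function.Bijective ((homologyFunctor C 0).map : (X ⟶ Y) → _) := by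
  let t := TStructure.t (C := C)
  let ι : (t.truncLE 0).obj Y ⟶ Y := (t.truncLEι 0).app Y
  -- The cone of `ι` has cohomology in degrees at least 1 only, so the long exact sequence makes
  -- `H^0(ι)` an isomorphism.
  have h₁ : IsIso ((homologyFunctor C 0).map ι) := by
    have hT := t.triangleLEGT_distinguished 0 Y
    have : IsGE ((t.triangleLEGT 0).obj Y).obj₃ 1 :=
      inferInstanceAs (t.IsGE ((t.truncGT 0).obj Y) (0 + 1))
    have : Mono ((homologyFunctor C 0).map ι) :=
      (HomologySequence.mono_homologyMap_mor₁_iff _ hT (-1) 0).2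
        ((isZero_of_isGE _ 1 (-1) (by lia)).eq_of_src _ _)
    have : Epi ((homologyFunctor C 0).map ι) :=
      (HomologySequence.epi_homologyMap_mor₁_iff _ hT 0).2
        ((isZero_of_isGE _ 1 0 (by lia)).eq_of_tgt _ _)
    exact isIso_of_mono_of_epi _
  have h₂ : Function.Bijective (fun f : X ⟶ (t.truncLE 0).obj Y => f ≫ ι) :=
    ⟨fun f g h => t.to_truncLE_obj_ext h, fun f => ⟨t.liftTruncLE f 0, t.liftTruncLE_ι f 0⟩⟩
  have : IsGE ((t.truncLE 0).obj Y) 0 := inferInstanceAs (t.IsGE ((t.truncLE 0).obj Y) 0)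
  have : IsLE ((t.truncLE 0).obj Y) 0 := inferInstanceAs (t.IsLE ((t.truncLE 0).obj Y) 0)
  -- Both objects are now modules placed in degree zero, where `C` embeds fully faithfully.
  obtain ⟨M, ⟨e⟩⟩ := X.exists_iso_singleFunctor_obj_of_isGE_of_isLE 0
  obtain ⟨N, ⟨e'⟩⟩ := ((t.truncLE 0).obj Y).exists_iso_singleFunctor_obj_of_isGE_of_isLE 0
  have h₃ : Function.Bijective ((homologyFunctor C 0).map : (X ⟶ (t.truncLE 0).obj Y) → _) := by
    have h : Function.Bijective ((singleFunctor C 0 ⋙ homologyFunctor C 0).map : (M ⟶ N) → _) :=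
      (Functor.FullyFaithful.ofIso (.id C)
        (singleFunctorCompHomologyFunctorIso C 0).symm).map_bijective _ _
    have h' : Function.Bijective ((homologyFunctor C 0).map :
        ((singleFunctor C 0).obj M ⟶ (singleFunctor C 0).obj N) → _) := by
      refine (Function.Bijective.of_comp_iff _
        ((Functor.FullyFaithful.ofFullyFaithful (singleFunctor C 0)).map_bijective M N)).1 h
    refine (Function.Bijective.of_comp_iff _ (Iso.homCongr e e').symm.bijective).1 ?_
    convert ((Iso.homCongr ((homologyFunctor C 0).mapIso e)
      ((homologyFunctor C 0).mapIso e')).symm.bijective.comp h') using 1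
    ext f
    simp
  refine (Function.Bijective.of_comp_iff _ h₂).1 ?_
  convert! (Iso.homCongr (Iso.refl _) (asIso ((homologyFunctor C 0).map ι))).bijective.comp h₃
  ext f
  simp

end HomologyInDegreeZero

/-! ### Comparison of `K^b(proj A)` with the derived category -/

section KbProj

variable {A : Type u} [CommRing A]

attribute [local instance] HasDerivedCategory.standard

lemma KbProj.isKProjective (X : KbProj A) : CochainComplex.IsKProjective X.obj.as := by
  obtain ⟨a, b, _, _⟩ := X.property.bounded
  have (n : ℤ) : Projective (X.obj.as.X n) :=
    (IsProjective.iff_projective _).1 (X.property.projective n)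
  exact CochainComplex.isKProjective_of_projective _ b

/-- The functor from `K^b(proj A)` to the derived category. -/
abbrev KbProj.toDerived : KbProj A ⥤ DerivedCategory (ModuleCat.{u} A) :=
  (kbProj A).ι ⋙ DerivedCategory.Qh

lemma KbProj.toDerived_map_bijective (X Y : KbProj A) :
    Function.Bijective (KbProj.toDerived.map : (X ⟶ Y) → _) :=
  have := X.isKProjective
  (CochainComplex.IsKProjective.Qh_map_bijective X.obj.as Y.obj).comp
    ((kbProj A).fullyFaithfulι.map_bijective X Y)

/-- The functor `H^n` on `K^b(proj A)`. -/
abbrev kbCohomology (A : Type u) [CommRing A] (n : ℤ) : KbProj A ⥤ ModuleCat.{u} A :=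
  (kbProj A).ι ⋙ HomotopyCategory.homologyFunctor _ _ n

/-- Cohomology may be computed in the derived category. -/
def KbProj.toDerivedCompHomology (n : ℤ) :
    KbProj.toDerived ⋙ DerivedCategory.homologyFunctor (ModuleCat.{u} A) n ≅ kbCohomology A n :=
  Functor.associator _ _ _ ≪≫
    Functor.isoWhiskerLeft _ (DerivedCategory.homologyFunctorFactorsh _ n)

lemma KbProj.isIso_iff {X Y : KbProj A} (f : X ⟶ Y) :
    IsIso f ↔ ∀ n, IsIso ((kbCohomology A n).map f) := by
  refine ⟨fun _ _ => inferInstance, fun h => ?_⟩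
  have : IsIso (KbProj.toDerived.map f) := by
    rw [DerivedCategory.isIso_iff]
    intro n
    exact (NatIso.isIso_map_iff (KbProj.toDerivedCompHomology n) f).2 (h n)
  obtain ⟨g, hg⟩ := (KbProj.toDerived_map_bijective _ _).2 (inv (KbProj.toDerived.map f))
  refine ⟨g, (KbProj.toDerived_map_bijective _ _).1 ?_, (KbProj.toDerived_map_bijective _ _).1 ?_⟩
  · rw [Functor.map_comp, hg]
    exact (IsIso.hom_inv_id _).trans (CategoryTheory.Functor.map_id _ _).symm
  · rw [Functor.map_comp, hg]
    exact (IsIso.inv_hom_id _).trans (CategoryTheory.Functor.map_id _ _).symm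

lemma KbProj.isZero_iff (X : KbProj A) : IsZero X ↔ ∀ n, IsZero (X.cohomology n) := by
  refine ⟨fun h n => (kbCohomology A n).map_isZero h, fun h => ?_⟩
  have : IsIso (0 : X ⟶ X) := (KbProj.isIso_iff _).2 fun n =>
    ⟨0, (h n).eq_of_src _ _, (h n).eq_of_src _ _⟩
  exact (IsZero.iff_id_eq_zero X).2 (by rw [← IsIso.hom_inv_id (0 : X ⟶ X), zero_comp])

/-- Morphisms from a complex with cohomology in degree zero only to a complex with cohomology in
nonnegative degrees are detected by the cohomology in degree zero. -/
lemma KbProj.cohomology_zero_map_bijective (X Y : KbProj A)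
    (hX : ∀ n ≠ 0, IsZero (X.cohomology n)) (hY : ∀ n < 0, IsZero (Y.cohomology n)) :
    Function.Bijective ((kbCohomology A 0).map : (X ⟶ Y) → _) := by
  have e (X : KbProj A) (n : ℤ) := ((KbProj.toDerivedCompHomology n).app X).isZero_iff
  have : (KbProj.toDerived.obj X).IsLE 0 :=
    (DerivedCategory.isLE_iff _ _).2 fun n hn => (e X n).2 (hX n hn.ne')
  have : (KbProj.toDerived.obj X).IsGE 0 :=
    (DerivedCategory.isGE_iff _ _).2 fun n hn => (e X n).2 (hX n hn.ne)
  have : (KbProj.toDerived.obj Y).IsGE 0 :=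
    (DerivedCategory.isGE_iff _ _).2 fun n hn => (e Y n).2 (hY n hn)
  convert! (Iso.homCongr ((KbProj.toDerivedCompHomology 0).app X)
    ((KbProj.toDerivedCompHomology 0).app Y)).bijective.comp
    ((DerivedCategory.homologyFunctor_zero_map_bijective _ _).comp
      (KbProj.toDerived_map_bijective X Y))
  ext f : 1
  exact (NatIso.naturality_1 (KbProj.toDerivedCompHomology 0) f).symm

end KbProj

/-! ### Serre classes of modules and the subcategories they define -/

section Supports

variable {A : Type u} [CommRing A]

/-- The modules of finite length with support contained in `S`. -/
def finiteLengthSupportedIn (S : Set (PrimeSpectrum A)) : ObjectProperty (ModuleCat.{u} A) :=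
  fun M => IsFiniteLength A M ∧ Module.support A M ⊆ S

instance (S : Set (PrimeSpectrum A)) : (finiteLengthSupportedIn S).IsSerreClass where
  exists_zero := ⟨.of A PUnit, ModuleCat.isZero_of_subsingleton _, .of_subsingleton, by
    rw [Module.support_eq_empty]; exact Set.empty_subset _⟩
  prop_of_mono f hf hN := by
    rw [ModuleCat.mono_iff_injective] at hf
    exact ⟨IsFiniteLength.of_injective (f := f.hom) hN.1 hf,
      (Module.support_subset_of_injective f.hom hf).trans hN.2⟩
  prop_of_epi f hf hM := by
    rw [ModuleCat.epi_iff_surjective] at hf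
    exact ⟨IsFiniteLength.of_surjective (f := f.hom) hM.1 hf,
      (Module.support_subset_of_surjective f.hom hf).trans hM.2⟩
  prop_X₂_of_shortExact {T} hT h₁ h₃ := by
    have hf := (ModuleCat.mono_iff_injective T.f).1 hT.mono_f
    have hg := (ModuleCat.epi_iff_surjective T.g).1 hT.epi_g
    have hfg := (ShortComplex.ShortExact.moduleCat_exact_iff_function_exact T).1 hT.exact
    refine ⟨?_, ?_⟩
    · have h₁ := h₁.1
      have h₃ := h₃.1
      rw [← Module.length_ne_top_iff] at h₁ h₃ ⊢
      rw [Module.length_eq_add_of_exact T.f.hom T.g.hom hf hg hfg]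
      simp [h₁, h₃]
    · rw [Module.support_of_exact hfg hf hg]
      exact Set.union_subset h₁.2 h₃.2

/-- The complexes in `K^b(proj A)` all of whose cohomology modules satisfy `W`. -/
def kbCohomologyIn (W : ObjectProperty (ModuleCat.{u} A)) : ObjectProperty (KbProj A) :=
  fun X => ∀ n : ℤ, W (X.cohomology n)

/-- The cohomology of a shifted complex. -/
def KbProj.cohomologyShiftIso (X : KbProj A) (a n m : ℤ) (h : a + n = m) :
    (X⟦a⟧).cohomology n ≅ X.cohomology m :=
  (HomotopyCategory.homologyFunctor _ _ n).mapIso (((kbProj A).ι.commShiftIso a).app X) ≪≫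
    ((HomotopyCategory.homologyFunctor (ModuleCat.{u} A) (ComplexShape.up ℤ) 0).shiftIso
      a n m h).app X.obj

instance (W : ObjectProperty (ModuleCat.{u} A)) [W.IsClosedUnderIsomorphisms] :
    (kbCohomologyIn W).IsClosedUnderIsomorphisms where
  of_iso e h n := W.prop_of_iso ((kbCohomology A n).mapIso e) (h n)

instance (W : ObjectProperty (ModuleCat.{u} A)) [W.IsSerreClass] :
    (kbCohomologyIn W).IsTriangulated where
  exists_zero := ⟨0, isZero_zero _, fun n =>
    W.prop_of_iso (((kbCohomology A n).map_isZero (isZero_zero _)).isoZero).symm W.prop_zero⟩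
  isStableUnderShiftBy a :=
    { le_shift X h n := W.prop_of_iso (X.cohomologyShiftIso a n _ rfl).symm (h (a + n)) }
  toIsTriangulatedClosed₂ := .mk' fun t ht h₁ h₃ n =>
    W.prop_X₂_of_exact ((kbCohomology A n).map_distinguished_exact t ht) (h₁ n) (h₃ n)

lemma isThick_kbCohomologyIn (W : ObjectProperty (ModuleCat.{u} A)) [W.IsSerreClass] :
    IsThick (kbCohomologyIn W) where
  isTriangulated := inferInstance
  isStableUnderRetracts :=
    { of_retract r h n := W.prop_of_mono ((kbCohomology A n).map r.i) (h n) }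

/-- The complexes in `K^b(proj A)` whose cohomology has finite length and support in `S`. -/
abbrev kbProjSupportedIn (S : Set (PrimeSpectrum A)) : ObjectProperty (KbProj A) :=
  kbCohomologyIn (finiteLengthSupportedIn S)

/-- Both kinds of subcategory are members of one family indexed by `S`, to which thickness and
dévissage apply uniformly. -/
lemma kbProjFiniteLength_eq : kbProjFiniteLength A = kbProjSupportedIn Set.univ := by
  ext X
  exact forall_congr' fun n => (and_iff_left (Set.subset_univ _)).symm

lemma kbProjSupportedAt_eq (m : MaximalSpectrum A) :
    kbProjSupportedAt m = kbProjSupportedIn {m.toPrimeSpectrum} := by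
  ext X
  exact (and_congr_right' Set.iUnion_subset_iff).trans forall_and.symm

lemma kbProjSupportedIn_mono {S S' : Set (PrimeSpectrum A)} (h : S ⊆ S') :
    kbProjSupportedIn S ≤ kbProjSupportedIn S' :=
  fun _ hX n => ⟨(hX n).1, (hX n).2.trans h⟩

/-- A complex in `K^b(proj A)` that is a resolution of the module `M`. -/
structure KbProj.IsResolution (P : KbProj A) (M : ModuleCat.{u} A) : Prop where
  nonempty_iso : Nonempty (P.cohomology 0 ≅ M)
  isZero (n : ℤ) (hn : n ≠ 0) : IsZero (P.cohomology n)

lemma finiteLengthSupportedIn_quotient (m : MaximalSpectrum A) {S : Set (PrimeSpectrum A)}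
    (hm : m.toPrimeSpectrum ∈ S) :
    finiteLengthSupportedIn S (ModuleCat.of A (A ⧸ m.asIdeal)) := by
  have := m.isMaximal
  have : IsSimpleModule A (A ⧸ m.asIdeal) := isSimpleModule_iff_quot_maximal.2
    ⟨m.asIdeal, m.isMaximal, ⟨.refl _ _⟩⟩
  refine ⟨Module.length_ne_top_iff.1 (by rw [Module.length_eq_one]; simp), fun p hp => ?_⟩
  have hp := Module.annihilator_le_of_mem_support hp
  rw [Ideal.annihilator_quotient] at hp
  have : p = m.toPrimeSpectrum :=
    PrimeSpectrum.ext (m.isMaximal.eq_of_le p.isPrime.ne_top hp).symm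
  rwa [this]

lemma KbProj.IsResolution.kbProjSupportedIn {P : KbProj A} {m : MaximalSpectrum A}
    (hP : P.IsResolution (ModuleCat.of A (A ⧸ m.asIdeal))) {S : Set (PrimeSpectrum A)}
    (hm : m.toPrimeSpectrum ∈ S) : kbProjSupportedIn S P := fun n => by
  by_cases hn : n = 0
  · subst hn
    exact ObjectProperty.prop_of_iso _ hP.nonempty_iso.some.symm
      (finiteLengthSupportedIn_quotient m hm)
  · exact ObjectProperty.prop_of_iso _ (hP.isZero n hn).isoZero.symm
      (ObjectProperty.prop_zero _)

/-- A nonzero Artinian module has a simple submodule; `m` is in the support as the annihilator of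
its generator. -/
lemma exists_quotient_mono {M : ModuleCat.{u} A} (hM : IsFiniteLength A M) (h0 : ¬ IsZero M) :
    ∃ m : MaximalSpectrum A, m.toPrimeSpectrum ∈ Module.support A M ∧
      ∃ f : ModuleCat.of A (A ⧸ m.asIdeal) ⟶ M, Mono f := by
  have := (isFiniteLength_iff_isNoetherian_isArtinian.1 hM).2
  have : Nontrivial M := by
    by_contra h
    have := not_nontrivial_iff_subsingleton.1 h
    exact h0 (ModuleCat.isZero_of_subsingleton M)
  obtain ⟨N, hN⟩ := IsAtomic.exists_atom (Submodule A M)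
  have : IsSimpleModule A N := isSimpleModule_iff_isAtom.2 hN
  obtain ⟨I, hI, ⟨e⟩⟩ := isSimpleModule_iff_quot_maximal.1 this
  have hinj : Function.Injective (N.subtype ∘ₗ e.symm.toLinearMap) :=
    N.injective_subtype.comp e.symm.injective
  refine ⟨⟨I, hI⟩, Module.support_subset_of_injective _ hinj ?_, ModuleCat.ofHom
    (N.subtype ∘ₗ e.symm.toLinearMap), (ModuleCat.mono_iff_injective _).2 hinj⟩
  rw [Module.mem_support_iff_exists_annihilator]
  refine ⟨Ideal.Quotient.mk I 1, fun a ha => ?_⟩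
  rw [Submodule.mem_annihilator_span_singleton] at ha
  have : a ∈ I := by simpa [Algebra.smul_def, Ideal.Quotient.eq_zero_iff_mem] using ha
  exact this

end Supports

/-! ### Dévissage by resolutions of simple modules -/

section Devissage

variable {A : Type u} [CommRing A]

/-- The cohomology of the cone of a morphism from a resolution of a module `M` which is injective on
cohomology in degree zero. -/
lemma KbProj.IsResolution.cohomology_cone {P : KbProj A} {M : ModuleCat.{u} A}
    (hP : P.IsResolution M) {X Y : KbProj A} {f : P ⟶ X} {g : X ⟶ Y} {h : Y ⟶ P⟦(1 : ℤ)⟧}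
    (hT : Triangle.mk f g h ∈ distTriang (KbProj A)) [Mono ((kbCohomology A 0).map f)] :
    Epi ((kbCohomology A 0).map g) ∧
      ∀ n ≠ 0, IsZero (X.cohomology n) → IsZero (Y.cohomology n) := by
  let F := HomotopyCategory.homologyFunctor (ModuleCat.{u} A) (ComplexShape.up ℤ) 0
  let t := (kbProj A).ι.mapTriangle.obj (Triangle.mk f g h)
  have ht : t ∈ distTriang _ := (kbProj A).ι.map_distinguished _ hT
  have key (n : ℤ) (hn : F.homologySequenceδ t n (n + 1) rfl = 0) :
      Epi ((kbCohomology A n).map g) :=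
    (F.homologySequence_epi_shift_map_mor₂_iff t ht n _ rfl).2 hn
  have hδ (n : ℤ) : Epi ((kbCohomology A n).map g) := by
    refine key n ?_
    -- Only for `n = -1` can the connecting map to `H^{n+1}(P)` be nonzero; there it vanishes
    -- because `H^0(f)` is injective.
    by_cases hn : n = -1
    · subst hn
      exact (F.homologySequence_mono_shift_map_mor₁_iff t ht (-1) 0 rfl).1
        (inferInstanceAs (Mono ((kbCohomology A 0).map f)))
    · exact (hP.isZero (n + 1) (by lia)).eq_of_tgt _ _
  exact ⟨hδ 0, fun n _ hX => have := hδ n; IsZero.of_epi ((kbCohomology A n).map g) hX⟩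

lemma length_lt_of_exact {M N L : ModuleCat.{u} A} (f : M ⟶ N) (g : N ⟶ L) (w : f ≫ g = 0)
    [Mono f] [Epi g] (hM : ¬ IsZero M) (hN : IsFiniteLength A N) :
    Module.length A L < Module.length A N := by
  have hg := (ModuleCat.epi_iff_surjective g).1 inferInstance
  have hf := (ModuleCat.mono_iff_injective f).1 inferInstance
  have hL := Module.length_ne_top_iff.2 (IsFiniteLength.of_surjective (f := g.hom) hN hg)
  have hlen := Module.length_eq_add_of_exact (LinearMap.ker g.hom).subtype g.hom
    (Submodule.injective_subtype _) hg (LinearMap.exact_subtype_ker_map _)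
  rw [hlen]
  refine ENat.lt_add_left hL ?_
  have : Nontrivial M := by
    by_contra h
    have := not_nontrivial_iff_subsingleton.1 h
    exact hM (ModuleCat.isZero_of_subsingleton M)
  obtain ⟨x, hx⟩ := exists_ne (0 : M)
  have : Nontrivial (LinearMap.ker g.hom) := by
    refine ⟨⟨⟨f x, ?_⟩, 0, ?_⟩⟩
    · exact congr($w x)
    · intro h
      exact hx (hf (by simpa using h))
  exact Module.length_pos

variable {S : Set (PrimeSpectrum A)} (Q : ObjectProperty (KbProj A)) [Q.IsTriangulated]
  [Q.IsClosedUnderIsomorphisms]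
  (hQ : ∀ m : MaximalSpectrum A, m.toPrimeSpectrum ∈ S →
    ∃ P : KbProj A, P.IsResolution (ModuleCat.of A (A ⧸ m.asIdeal)) ∧ Q P)

include hQ in
-- Double induction: on the width `N` of the range of degrees, then on the length of `H^0(X)`. When
-- `H^0(X) = 0`, a shift lowers the width.
lemma prop_of_cohomology_bounded (N : ℕ) (X : KbProj A) (hX : kbProjSupportedIn S X)
    (hneg : ∀ n < 0, IsZero (X.cohomology n)) (hpos : ∀ n ≥ (N : ℤ), IsZero (X.cohomology n)) :
    Q X := by
  induction N generalizing X with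
  | zero =>
    refine Q.prop_of_isZero ((KbProj.isZero_iff X).2 fun n => ?_)
    obtain h | h := lt_or_ge n 0
    · exact hneg n h
    · exact hpos n (by simpa using h)
  | succ N ih =>
    induction hl : Module.length A (X.cohomology 0) using WellFoundedLT.induction
      generalizing X with
    | ind l ih' =>
    by_cases h0 : IsZero (X.cohomology 0)
    · have : Q (X⟦(1 : ℤ)⟧) := by
        refine ih _ ((kbProjSupportedIn S).le_shift 1 X hX) (fun n hn => ?_) (fun n hn => ?_)
        · refine IsZero.of_iso ?_ (X.cohomologyShiftIso 1 n _ rfl)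
          by_cases h : 1 + n = 0
          · rwa [h]
          · exact hneg _ (by lia)
        · exact IsZero.of_iso (hpos _ (by push_cast; lia)) (X.cohomologyShiftIso 1 n _ rfl)
      exact Q.prop_of_iso ((shiftEquiv (KbProj A) (1 : ℤ)).unitIso.symm.app X)
        (Q.le_shift (-1) _ this)
    · obtain ⟨m, hm, f, hf⟩ := exists_quotient_mono (hX 0).1 h0
      obtain ⟨P, hP, hQP⟩ := hQ m ((hX 0).2 hm)
      obtain ⟨φ, hφ⟩ := (KbProj.cohomology_zero_map_bijective P X hP.isZero hneg).2
        (hP.nonempty_iso.some.hom ≫ f)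
      obtain ⟨Y, g, h, hT⟩ := distinguished_cocone_triangle φ
      have : Mono ((kbCohomology A 0).map φ) := by rw [hφ]; infer_instance
      obtain ⟨hepi, hY⟩ := hP.cohomology_cone hT
      refine Q.ext_of_isTriangulatedClosed₂ _ hT hQP (ih' _ ?_ Y ?_ ?_ ?_ rfl)
      · rw [← hl]
        refine length_lt_of_exact ((kbCohomology A 0).map φ) ((kbCohomology A 0).map g) ?_ ?_
          (hX 0).1
        · rw [← Functor.map_comp]
          exact (congrArg _ (comp_distTriang_mor_zero₁₂ _ hT)).trans (Functor.map_zero _ _ _)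
        · intro h
          have := m.isMaximal
          have : Nontrivial (A ⧸ m.asIdeal) := Ideal.Quotient.nontrivial_iff.2 this.ne_top
          exact not_subsingleton (A ⧸ m.asIdeal)
            (ModuleCat.subsingleton_of_isZero (h.of_iso hP.nonempty_iso.some.symm))
      · exact (kbProjSupportedIn S).ext_of_isTriangulatedClosed₃ _ hT
          (hP.kbProjSupportedIn ((hX 0).2 hm)) hX
      · exact fun n hn => hY n hn.ne (hneg n hn)
      · exact fun n hn => hY n (by push_cast at hn; lia) (hpos n hn)

include hQ in
/-- A triangulated subcategory that contains a resolution of `A ⧸ m` for each maximal ideal `m` in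
`S` contains all complexes whose cohomology has finite length and support in `S`. -/
theorem kbProjSupportedIn_le : kbProjSupportedIn S ≤ Q := fun X hX => by
  obtain ⟨a, b, _, _⟩ := X.property.bounded
  have hb (n : ℤ) (hn : n < a ∨ b < n) : IsZero (X.cohomology n) := by
    refine IsZero.of_iso ?_ ((HomotopyCategory.homologyFunctorFactors _ _ n).app X.obj.as)
    refine ((HomologicalComplex.exactAt_iff_isZero_homology _ _).1 ?_)
    refine HomologicalComplex.ExactAt.of_isZero ?_
    obtain hn | hn := hn
    · exact CochainComplex.isZero_of_isStrictlyGE X.obj.as a n hn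
    · exact CochainComplex.isZero_of_isStrictlyLE X.obj.as b n hn
  have : Q (X⟦a⟧) := by
    refine prop_of_cohomology_bounded Q hQ (b + 1 - a).toNat _
      ((kbProjSupportedIn S).le_shift a X hX) (fun n hn => ?_) (fun n hn => ?_)
    · exact IsZero.of_iso (hb _ (by lia)) (X.cohomologyShiftIso a n _ rfl)
    · exact IsZero.of_iso (hb _ (by lia)) (X.cohomologyShiftIso a n _ rfl)
  exact Q.prop_of_iso ((shiftEquiv (KbProj A) a).unitIso.symm.app X) (Q.le_shift (-a) _ this)

end Devissage

/-! ### Linearity, and morphisms between resolutions of simple modules -/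

section Linear

variable {A : Type u} [CommRing A]

section

variable {R C : Type*} [Ring R] [Category* C] [Abelian C] [CategoryTheory.Linear R C]
  (n : ℤ)

instance : (HomologicalComplex.shortComplexFunctor C (ComplexShape.up ℤ) n).Linear R where

instance : (HomologicalComplex.homologyFunctor C (ComplexShape.up ℤ) n).Linear R :=
  Functor.linear_of_iso (R := R) (HomologicalComplex.homologyFunctorIso C (.up ℤ) n).symm

instance : (HomotopyCategory.homologyFunctor C (ComplexShape.up ℤ) n).Linear R :=
  have := Functor.linear_of_iso (R := R)
    (HomotopyCategory.homologyFunctorFactors C (ComplexShape.up ℤ) n).symm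
  Functor.linear_of_full_essSurj_comp (HomotopyCategory.quotient _ _) _

end

/-- Needed so that scalars annihilating a complex also annihilate its shifts. -/
instance (n : ℤ) : (shiftFunctor (KbProj A) n).Linear A where
  map_smul {X Y} f r := by
    apply (kbProj A).ι.map_injective
    have h (f : X ⟶ Y) := NatIso.naturality_2 ((kbProj A).ι.commShiftIso n) f
    refine (h (r • f)).symm.trans ?_
    refine (?_ : _ = _).trans (congrArg (r • ·) (h f))
    rw [Functor.map_smul, Linear.smul_comp, Linear.comp_smul]

namespace KbProj.IsResolution

variable {P P' : KbProj A} {m m' : MaximalSpectrum A}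
  (hP : P.IsResolution (ModuleCat.of A (A ⧸ m.asIdeal)))
  (hP' : P'.IsResolution (ModuleCat.of A (A ⧸ m'.asIdeal)))

include hP

/-- Endomorphisms of `P` are detected on `H^0(P) ≅ A ⧸ m`, which `m` kills. -/
lemma smul_id_eq_zero {r : A} (hr : r ∈ m.asIdeal) : r • 𝟙 P = 0 := by
  apply (KbProj.cohomology_zero_map_bijective P P hP.isZero fun n hn => hP.isZero n hn.ne).1
  rw [Functor.map_smul, Functor.map_zero, CategoryTheory.Functor.map_id]
  have e := hP.nonempty_iso.some
  have h : r • 𝟙 (ModuleCat.of A (A ⧸ m.asIdeal)) = 0 := by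
    ext
    have : Ideal.Quotient.mk m.asIdeal r = 0 := Ideal.Quotient.eq_zero_iff_mem.2 hr
    simp [Algebra.smul_def, this]
  rw [← cancel_mono e.hom, zero_comp, Linear.smul_comp, Category.id_comp,
    ← Category.comp_id e.hom, ← Linear.comp_smul, h, comp_zero]

include hP' in
lemma hom_shift_eq_zero (h : m ≠ m') (n : ℤ) (f : P ⟶ P'⟦n⟧) : f = 0 := by
  have hmm' := m.isMaximal.coprime_of_ne m'.isMaximal fun h' => h (MaximalSpectrum.ext h')
  -- With `s + t = 1`, `s` kills `f` through its source and `t` through its target.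
  obtain ⟨s, hs, t, ht, hst⟩ := Submodule.mem_sup.1 ((Ideal.eq_top_iff_one _).1 hmm')
  have h₁ : s • f = 0 := by
    rw [← Category.id_comp f, ← Linear.smul_comp, hP.smul_id_eq_zero hs, zero_comp]
  have h₂ : t • f = 0 := by
    rw [← Category.comp_id f, ← Linear.comp_smul, ← CategoryTheory.Functor.map_id,
      ← Functor.map_smul, hP'.smul_id_eq_zero ht, Functor.map_zero, comp_zero]
  rw [← one_smul A f, ← hst, add_smul, h₁, h₂, add_zero]

lemma simple_cohomology : Simple (P.cohomology 0) := by
  have : IsSimpleModule A (A ⧸ m.asIdeal) := isSimpleModule_iff_quot_maximal.2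
    ⟨m.asIdeal, m.isMaximal, ⟨.refl _ _⟩⟩
  have : Simple (ModuleCat.of A (A ⧸ m.asIdeal)) := simple_of_isSimpleModule
  exact Simple.of_iso hP.nonempty_iso.some

/-- Schur's lemma on `H^0(P)`, the only nonzero cohomology. -/
lemma isIso_of_ne_zero {f : P ⟶ P} (hf : f ≠ 0) : IsIso f := by
  have : Simple ((kbCohomology A 0).obj P) := hP.simple_cohomology
  rw [KbProj.isIso_iff]
  intro n
  by_cases hn : n = 0
  · subst hn
    refine isIso_of_hom_simple fun h => hf ?_
    apply (KbProj.cohomology_zero_map_bijective P P hP.isZero fun n hn => hP.isZero n hn.ne).1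
    rw [h, Functor.map_zero]
  · exact ⟨0, (hP.isZero n hn).eq_of_src _ _, (hP.isZero n hn).eq_of_src _ _⟩

lemma not_isZero : ¬ IsZero P := fun h => by
  have := hP.simple_cohomology
  exact Simple.not_isZero _ ((KbProj.isZero_iff P).1 h 0)

/-- A resolution of a simple module is indecomposable. -/
lemma exists_iso_of_iso_biproduct {J : Type} [Finite J] {Y : J → KbProj A} (e : P ≅ ⨁ Y) :
    ∃ j, Nonempty (P ≅ Y j) := by
  classical
  have := Fintype.ofFinite J
  -- The identity of `P` is the sum of these endomorphisms; a nonzero one is invertible and makes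
  -- `P` isomorphic to `Y j`.
  obtain ⟨j, hj⟩ : ∃ j, e.hom ≫ biproduct.π Y j ≫ biproduct.ι Y j ≫ e.inv ≠ 0 := by
    by_contra! h
    refine hP.not_isZero ((IsZero.iff_id_eq_zero P).2 ?_)
    have h' : e.hom ≫ (∑ j, biproduct.π Y j ≫ biproduct.ι Y j) ≫ e.inv = 0 := by
      simp only [Preadditive.sum_comp, Preadditive.comp_sum, Category.assoc, h,
        Finset.sum_const_zero]
    rwa [biproduct.total, Category.id_comp, e.hom_inv_id] at h'
  have := hP.isIso_of_ne_zero hj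
  have : Mono (e.hom ≫ biproduct.π Y j) := by
    rw [← Category.assoc] at this
    exact mono_of_mono _ (biproduct.ι Y j ≫ e.inv)
  have : IsSplitEpi (e.hom ≫ biproduct.π Y j) := ⟨⟨biproduct.ι Y j ≫ e.inv, by simp⟩⟩
  have := isIso_of_mono_of_isSplitEpi (e.hom ≫ biproduct.π Y j)
  exact ⟨j, ⟨asIso (e.hom ≫ biproduct.π Y j)⟩⟩

end KbProj.IsResolution

end Linear

/-! ### Orthogonality, decomposition and connectedness -/

section Decomposition

variable {A : Type u} [CommRing A]

/-- Dévissage applied to the left orthogonal of `Q`, which is triangulated because `Q` is stable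
under shifts. -/
lemma kbProjSupportedIn_eq_zero_of_hom {P X : KbProj A} {m : MaximalSpectrum A}
    (hP : P.IsResolution (ModuleCat.of A (A ⧸ m.asIdeal)))
    (hX : kbProjSupportedIn {m.toPrimeSpectrum} X) (Q : ObjectProperty (KbProj A))
    [Q.IsStableUnderShift ℤ] (hQ : Q.leftOrthogonal P) {Y : KbProj A} (hY : Q Y)
    (f : X ⟶ Y) : f = 0 :=
  kbProjSupportedIn_le Q.leftOrthogonal (fun m' hm' => by
    obtain rfl := MaximalSpectrum.toPrimeSpectrum_injective hm'
    exact ⟨P, hP, hQ⟩) X hX f hY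

variable (hres : ∀ m : MaximalSpectrum A, ∃ P : KbProj A,
  P.IsResolution (ModuleCat.of A (A ⧸ m.asIdeal)))

include hres

lemma isOrthogonalFamily_kbProjSupportedAt :
    IsOrthogonalFamily fun m : MaximalSpectrum A => kbProjSupportedAt m := by
  intro m m' hmm' X Y hX hY f
  rw [kbProjSupportedAt_eq] at hX hY
  obtain ⟨P, hP⟩ := hres m
  obtain ⟨P', hP'⟩ := hres m'
  -- All shifts of `P'` are taken together so that the left orthogonal of `W` is triangulated.
  let W : ObjectProperty (KbProj A) := fun Z => ∃ n : ℤ, Nonempty (Z ≅ P'⟦n⟧)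
  have : W.IsStableUnderShift ℤ :=
    { isStableUnderShiftBy a :=
        { le_shift := by
            rintro Z ⟨n, ⟨e⟩⟩
            exact ⟨n + a,
              ⟨(shiftFunctor _ a).mapIso e ≪≫ ((shiftFunctorAdd _ n a).app P').symm⟩⟩ } }
  refine kbProjSupportedIn_le (kbProjSupportedIn {m.toPrimeSpectrum}).rightOrthogonal
    (fun n hn => ?_) Y hY f hX
  obtain rfl := MaximalSpectrum.toPrimeSpectrum_injective hn
  refine ⟨P', hP', fun X f hX => kbProjSupportedIn_eq_zero_of_hom hP hX W ?_
    ⟨0, ⟨((shiftFunctorZero _ ℤ).app P').symm⟩⟩ f⟩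
  rintro Z f ⟨a, ⟨e⟩⟩
  rw [← cancel_mono e.hom, zero_comp, hP.hom_shift_eq_zero hP' hmm' a (f ≫ e.hom)]

theorem isTriangulatedDirectSum_kbProjFiniteLength :
    IsTriangulatedDirectSum (kbProjFiniteLength A)
      (fun m : MaximalSpectrum A => kbProjSupportedAt m) := by
  have htri (m : MaximalSpectrum A) : (kbProjSupportedAt m).IsTriangulated := by
    rw [kbProjSupportedAt_eq]; infer_instance
  have hiso (m : MaximalSpectrum A) : (kbProjSupportedAt m).IsClosedUnderIsomorphisms := by
    rw [kbProjSupportedAt_eq]; infer_instance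
  have horth := isOrthogonalFamily_kbProjSupportedAt hres
  refine ⟨htri, hiso, fun X => ⟨fun hX => ?_, ?_⟩, fun h _ _ hX hY f => horth h hX hY f,
    horth.productTriangle_distinguished_iff htri⟩
  · have := horth.isTriangulated_finiteSums htri hiso
    rw [kbProjFiniteLength_eq] at hX
    refine kbProjSupportedIn_le (finiteSums _) (fun m _ => ?_) X hX
    obtain ⟨P, hP⟩ := hres m
    refine ⟨P, hP, le_finiteSums m P ?_⟩
    rw [kbProjSupportedAt_eq]
    exact hP.kbProjSupportedIn rfl
  · rintro ⟨s, Y, hY, ⟨e⟩⟩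
    rw [kbProjFiniteLength_eq]
    refine ObjectProperty.prop_of_iso _ (e ≪≫ biproduct.isoProduct Y).symm
      (ObjectProperty.prop_product _ fun i => ?_)
    have := hY i
    rw [kbProjSupportedAt_eq] at this
    exact kbProjSupportedIn_mono (Set.subset_univ _) _ this

theorem isLeast_kbProjFiniteLength :
    IsLeast {Q : ObjectProperty (KbProj A) | IsThick Q ∧
      ∀ m : MaximalSpectrum A, kbProjSupportedAt m ≤ Q} (kbProjFiniteLength A) := by
  rw [kbProjFiniteLength_eq]
  refine ⟨⟨isThick_kbCohomologyIn _, fun m => ?_⟩, fun Q hQ => ?_⟩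
  · rw [kbProjSupportedAt_eq]
    exact kbProjSupportedIn_mono (Set.subset_univ _)
  · have := hQ.1.isTriangulated
    have := hQ.1.isStableUnderRetracts
    refine kbProjSupportedIn_le Q fun m _ => ?_
    obtain ⟨P, hP⟩ := hres m
    refine ⟨P, hP, hQ.2 m P ?_⟩
    rw [kbProjSupportedAt_eq]
    exact hP.kbProjSupportedIn rfl

theorem isConnectedTriangulated_kbProjSupportedAt (m : MaximalSpectrum A) :
    IsConnectedTriangulated (kbProjSupportedAt m) := by
  rw [kbProjSupportedAt_eq]
  obtain ⟨P, hP⟩ := hres m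
  have hPm : kbProjSupportedIn {m.toPrimeSpectrum} P := hP.kbProjSupportedIn rfl
  refine ⟨⟨P, hPm, hP.not_isZero⟩, fun P₁ P₂ h => ?_⟩
  obtain ⟨s, Y, hY, ⟨e⟩⟩ := (h.prop_iff P).1 hPm
  obtain ⟨i, ⟨e'⟩⟩ := hP.exists_iso_of_iso_biproduct e
  have := h.isClosedUnderIsomorphisms i
  have hPi : ![P₁, P₂] i P := ObjectProperty.prop_of_iso _ e'.symm (hY i)
  -- `P` is left orthogonal to the other summand, hence so is every object supported at `m`. An
  -- object of that summand therefore has zero identity.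
  have key (j : Fin 2) (hij : (i : Fin 2) ≠ j) (X : KbProj A) (hX : ![P₁, P₂] j X) : IsZero X := by
    have := h.isTriangulated j
    exact (IsZero.iff_id_eq_zero X).2 (kbProjSupportedIn_eq_zero_of_hom hP
      ((h.prop_iff X).2 (le_finiteSums j X hX)) _ (fun Z f hZ => h.hom_eq_zero hij hPi hZ f) hX _)
  obtain hi | hi := (by grind : (i : Fin 2) ≠ 0 ∨ (i : Fin 2) ≠ 1)
  · exact Or.inl (key 0 hi)
  · exact Or.inr (key 1 hi)

/-- The nonempty support of `H^0(P)` would lie in both singletons. -/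
theorem kbProjSupportedAt_injective :
    Function.Injective fun m : MaximalSpectrum A => kbProjSupportedAt m := by
  intro m m' h
  obtain ⟨P, hP⟩ := hres m
  have hPm : kbProjSupportedAt m P := by
    rw [kbProjSupportedAt_eq]
    exact hP.kbProjSupportedIn rfl
  have hPm' : kbProjSupportedAt m' P :=
    (congrFun (h : kbProjSupportedAt m = kbProjSupportedAt m') P).mp hPm
  rw [kbProjSupportedAt_eq] at hPm hPm'
  have : Nontrivial (P.cohomology 0) := by
    have := hP.simple_cohomology
    by_contra hn
    have := not_nontrivial_iff_subsingleton.1 hn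
    exact Simple.not_isZero (P.cohomology 0) (ModuleCat.isZero_of_subsingleton _)
  obtain ⟨p, hp⟩ := Module.nonempty_support_of_nontrivial (R := A) (M := P.cohomology 0)
  exact MaximalSpectrum.toPrimeSpectrum_injective
    (((hPm 0).2 hp).symm.trans ((hPm' 0).2 hp))

end Decomposition

/-! ### Koszul resolutions as iterated cones -/

section Koszul

open scoped Pointwise

variable {A : Type u} [CommRing A]

lemma isBoundedProj_single (M : ModuleCat.{u} A) [Module.Finite A M] [Module.Projective A M] :
    IsBoundedProj A ((HomologicalComplex.single _ _ 0).obj M) := by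
  have e :
      ((HomologicalComplex.single (ModuleCat.{u} A) (ComplexShape.up ℤ) 0).obj M).X 0 ≃ₗ[A] M :=
    (HomologicalComplex.singleObjXSelf _ _ _).toLinearEquiv
  have h (n : ℤ) (hn : n ≠ 0) : Subsingleton
      (((HomologicalComplex.single (ModuleCat.{u} A) (ComplexShape.up ℤ) 0).obj M).X n) :=
    ModuleCat.subsingleton_of_isZero (HomologicalComplex.isZero_single_obj_X _ _ _ _ hn)
  refine ⟨fun n => ?_, fun n => ?_, 0, 0, ?_, ?_⟩
  · obtain rfl | hn := eq_or_ne n 0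
    · exact Module.Finite.equiv e.symm
    · have := h n hn
      infer_instance
  · obtain rfl | hn := eq_or_ne n 0
    · exact Module.Projective.of_equiv e.symm
    · have := h n hn
      infer_instance
  · rw [CochainComplex.isStrictlyGE_iff]
    exact fun i hi => HomologicalComplex.isZero_single_obj_X _ _ _ _ hi.ne
  · rw [CochainComplex.isStrictlyLE_iff]
    exact fun i hi => HomologicalComplex.isZero_single_obj_X _ _ _ _ hi.ne'

lemma KbProj.exists_isResolution_of_projective (M : ModuleCat.{u} A) [Module.Finite A M]
    [Module.Projective A M] : ∃ P : KbProj A, P.IsResolution M := by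
  let K := (HomologicalComplex.single (ModuleCat.{u} A) (ComplexShape.up ℤ) 0).obj M
  have e (n : ℤ) := (HomotopyCategory.homologyFunctorFactors
    (ModuleCat.{u} A) (ComplexShape.up ℤ) n).app K
  refine ⟨⟨(HomotopyCategory.quotient _ _).obj K, isBoundedProj_single M⟩,
    ⟨e 0 ≪≫ (HomologicalComplex.homologyFunctorSingleIso _ _ 0).app M⟩, fun n hn => ?_⟩
  exact IsZero.of_iso (HomologicalComplex.isZero_single_obj_homology _ _ _ _ hn) (e n)

/-- If `r` is a nonzerodivisor on `M`, the cone of the multiplication by `r` on a resolution of `M`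
is a resolution of `M / r M`. -/
lemma KbProj.IsResolution.exists_quotSMulTop {P : KbProj A} {M : ModuleCat.{u} A}
    (hP : P.IsResolution M) {r : A} (hr : IsSMulRegular M r) :
    ∃ Q : KbProj A, Q.IsResolution (ModuleCat.of A (QuotSMulTop r M)) := by
  obtain ⟨Y, g, h, hT⟩ := distinguished_cocone_triangle (r • 𝟙 P)
  obtain ⟨e⟩ := hP.nonempty_iso
  have hmap : (kbCohomology A 0).map (r • 𝟙 P) = r • 𝟙 (P.cohomology 0) := by
    rw [Functor.map_smul, CategoryTheory.Functor.map_id]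
    rfl
  have : Mono ((kbCohomology A 0).map (r • 𝟙 P)) := by
    rw [hmap, ModuleCat.mono_iff_injective]
    intro x y hxy
    have hxy : r • x = r • y := hxy
    refine e.toLinearEquiv.injective (hr ?_)
    change r • e.toLinearEquiv x = r • e.toLinearEquiv y
    rw [← map_smul, hxy, map_smul]
  obtain ⟨hepi, hzero⟩ := hP.cohomology_cone hT
  have hex := (kbCohomology A 0).map_distinguished_exact _ hT
  rw [ShortComplex.moduleCat_exact_iff] at hex
  let φ : M →ₗ[A] Y.cohomology 0 := ((kbCohomology A 0).map g).hom ∘ₗ e.inv.hom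
  have hφ : Function.Surjective φ :=
    ((ModuleCat.epi_iff_surjective _).1 hepi).comp e.toLinearEquiv.symm.surjective
  -- Exactness of `H^0(P) ⟶ H^0(P) ⟶ H^0(Y)`, whose first map is multiplication by `r`, transported
  -- along `H^0(P) ≅ M`.
  have hker : r • (⊤ : Submodule A M) = LinearMap.ker φ := by
    ext x
    rw [Submodule.mem_smul_pointwise_iff_exists, LinearMap.mem_ker]
    constructor
    · rintro ⟨y, -, rfl⟩
      have hw : (r • 𝟙 P) ≫ g = 0 := comp_distTriang_mor_zero₁₂ _ hT
      have hw := congr((kbCohomology A 0).map $hw (e.inv y))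
      rw [Functor.map_comp, hmap, Functor.map_zero] at hw
      have hw : ((kbCohomology A 0).map g).hom (r • e.inv y) = 0 := hw
      rw [map_smul] at hw ⊢
      exact hw
    · intro hx
      obtain ⟨z, hz⟩ := hex (e.inv x) hx
      refine ⟨e.hom z, trivial, ?_⟩
      have hz : (kbCohomology A 0).map (r • 𝟙 P) z = e.inv x := hz
      rw [hmap] at hz
      have hz : r • z = e.inv x := hz
      exact (e.toLinearEquiv.map_smul r z).symm.trans
        ((congrArg e.toLinearEquiv hz).trans (e.toLinearEquiv.apply_symm_apply x))
  refine ⟨Y, ⟨?_⟩, fun n hn => hzero n hn (hP.isZero n hn)⟩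
  exact ((Submodule.quotEquivOfEq _ _ hker).trans
    (φ.quotKerEquivOfSurjective hφ)).symm.toModuleIso

lemma KbProj.IsResolution.of_iso {P : KbProj A} {M N : ModuleCat.{u} A} (hP : P.IsResolution M)
    (e : M ≅ N) : P.IsResolution N :=
  ⟨hP.nonempty_iso.map (· ≪≫ e), hP.isZero⟩

/-- The Koszul complex of a regular sequence. -/
lemma KbProj.IsResolution.exists_of_isWeaklyRegular {P : KbProj A} {M : ModuleCat.{u} A}
    (hP : P.IsResolution M) {rs : List A} (hrs : RingTheory.Sequence.IsWeaklyRegular M rs) :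
    ∃ Q : KbProj A,
      Q.IsResolution (ModuleCat.of A (M ⧸ (Ideal.ofList rs • ⊤ : Submodule A M))) := by
  induction rs generalizing P M with
  | nil => exact ⟨P, hP.of_iso (Submodule.quotEquivOfEqBot _ (by simp)).symm.toModuleIso⟩
  | cons r rs ih =>
    rw [RingTheory.Sequence.isWeaklyRegular_cons_iff] at hrs
    obtain ⟨Q, hQ⟩ := hP.exists_quotSMulTop hrs.1
    obtain ⟨Q', hQ'⟩ := ih hQ hrs.2
    exact ⟨Q', hQ'.of_iso
      (Submodule.quotOfListConsSMulTopEquivQuotSMulTopInner M r rs).symm.toModuleIso⟩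

lemma KbProj.exists_isResolution_quotient {rs : List A}
    (hrs : RingTheory.Sequence.IsWeaklyRegular A rs) {I : Ideal A} (hI : Ideal.ofList rs = I) :
    ∃ P : KbProj A, P.IsResolution (ModuleCat.of A (A ⧸ I)) := by
  obtain ⟨P, hP⟩ := KbProj.exists_isResolution_of_projective (ModuleCat.of A A)
  obtain ⟨Q, hQ⟩ := hP.exists_of_isWeaklyRegular hrs
  exact ⟨Q, hQ.of_iso (Submodule.quotEquivOfEq _ _ (by simp [← hI])).toModuleIso⟩

end Koszul

/-! ### Regular sequences generating maximal ideals of polynomial rings -/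

section RegularSequence

open Polynomial RingTheory.Sequence

variable {R : Type u} [CommRing R]

/-- The quotient is `(R ⧸ I)[X]`, which is never a field: `X` is neither zero nor invertible unless
`I` is the unit ideal. -/
lemma Polynomial.map_C_not_isMaximal (I : Ideal R) : ¬ (I.map (C : R →+* R[X])).IsMaximal := by
  intro h
  have hX : (X : R[X]) ∉ I.map C → False := by
    intro hX
    obtain ⟨p, hp⟩ := h.exists_inv hX
    obtain ⟨q, hq, hpq⟩ := hp
    have h0 := (Ideal.mem_map_C_iff.1 hq) 0
    refine h.ne_top ?_
    rw [(Ideal.eq_top_iff_one I).2 ?_, Ideal.map_top]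
    have := congr(coeff $hpq 0)
    simp only [coeff_add, mul_coeff_zero, coeff_X_zero, mul_zero, zero_add, coeff_one_zero] at this
    rwa [this] at h0
  refine hX fun hX => h.ne_top ?_
  have := Ideal.mem_map_C_iff.1 hX 1
  rw [coeff_X_one, ← Ideal.eq_top_iff_one] at this
  rw [this, Ideal.map_top]

lemma isSMulRegular_quotient_of_notMem (I : Ideal R) [I.IsPrime] {f : R} (hf : f ∉ I) :
    IsSMulRegular (R ⧸ I) f := by
  refine isSMulRegular_iff_right_eq_zero_of_smul.2 fun x hx => ?_
  rw [Algebra.smul_def, mul_eq_zero] at hx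
  exact hx.resolve_left fun h => hf (Ideal.Quotient.eq_zero_iff_mem.1 h)

/-- Every maximal ideal of `R` is generated by a regular sequence. -/
def MaximalIdealsRegular (R : Type u) [CommRing R] : Prop :=
  ∀ I : Ideal R, I.IsMaximal → ∃ rs : List R, IsWeaklyRegular R rs ∧ Ideal.ofList rs = I

lemma MaximalIdealsRegular.of_field (K : Type u) [Field K] : MaximalIdealsRegular K := fun I hI =>
  ⟨[], .nil _ _, by rw [Ideal.ofList_nil, Ideal.eq_bot_of_prime I]⟩

lemma MaximalIdealsRegular.of_ringEquiv {S : Type v} [CommRing S] (e : R ≃+* S)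
    (h : MaximalIdealsRegular R) : MaximalIdealsRegular S := by
  intro I hI
  obtain ⟨rs, hrs, hI'⟩ := h (I.comap e) (Ideal.comap_isMaximal_of_equiv e)
  refine ⟨rs.map e, ?_, ?_⟩
  · refine (AddEquiv.isWeaklyRegular_congr (e := e.toAddEquiv) ?_).1 hrs
    exact List.forall₂_map_right_iff.2 (List.forall₂_same.2 fun r _ x => map_mul e r x)
  · have := Ideal.map_ofList e.toRingHom rs
    rw [hI'] at this
    exact this.symm.trans (Ideal.map_comap_of_surjective _ e.surjective _)

/-- The contraction of `I` is maximal by the Jacobson property, and its regular sequence stays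
regular by flatness. Modulo the extended contraction, `I` needs one further generator `f`, which is
regular because the extended ideal is prime and does not contain `f`. -/
lemma MaximalIdealsRegular.polynomial [IsJacobsonRing R] (h : MaximalIdealsRegular R) :
    MaximalIdealsRegular R[X] := by
  intro I hI
  have hm := isMaximal_comap_C_of_isJacobsonRing I
  have hne : I ≠ (I.comap C).map C := fun h => map_C_not_isMaximal _ (h ▸ hI)
  obtain ⟨f, -, hf⟩ := exists_monic_span_sup_map_eq R I hm hne
  obtain ⟨rs, hrs, hI'⟩ := h _ hm
  have hmap : Ideal.ofList (rs.map (C : R →+* R[X])) = (I.comap C).map C := by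
    rw [← Ideal.map_ofList, hI']
  have := hm.isPrime
  have hfI : f ∉ (I.comap C).map (C : R →+* R[X]) := by
    intro hmem
    refine hne (hf.trans (sup_eq_left.2 ?_))
    rwa [Ideal.span_singleton_le_iff_mem]
  refine ⟨rs.map C ++ [f], ?_, ?_⟩
  · rw [isWeaklyRegular_append_iff, isWeaklyRegular_singleton_iff]
    refine ⟨hrs.of_flat, ?_⟩
    have hreg := isSMulRegular_quotient_of_notMem _ hfI
    refine ((Submodule.quotEquivOfEq _ _ ?_).isSMulRegular_congr f).1 hreg
    rw [hmap, smul_eq_mul, Ideal.mul_top]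
  · rw [Ideal.ofList_append, Ideal.ofList_singleton, hmap, ← hf]

lemma maximalIdealsRegular_mvPolynomial (k : Type u) [Field k] (d : ℕ) :
    MaximalIdealsRegular (MvPolynomial (Fin d) k) := by
  induction d with
  | zero =>
    exact (MaximalIdealsRegular.of_field k).of_ringEquiv
      (MvPolynomial.isEmptyRingEquiv k (Fin 0)).symm
  | succ d ih =>
    exact ih.polynomial.of_ringEquiv (MvPolynomial.finSuccEquiv k d).symm.toRingEquiv

end RegularSequence

/-! ### Infinitude of the maximal spectrum -/

lemma infinite_maximalSpectrum {R : Type u} [CommRing R] [IsDomain R] [IsJacobsonRing R]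
    (hR : ¬ IsField R) : Infinite (MaximalSpectrum R) := by
  by_contra hfin
  rw [not_infinite_iff_finite] at hfin
  have := Fintype.ofFinite (MaximalSpectrum R)
  have h (m : MaximalSpectrum R) : ∃ x ∈ m.asIdeal, x ≠ 0 :=
    m.asIdeal.exists_mem_ne_zero_of_ne_bot (Ring.ne_bot_of_isMaximal_of_not_isField m.isMaximal hR)
  choose x hx hx0 using h
  -- A product of nonzero elements, one from each maximal ideal, lies in the Jacobson radical, which
  -- is zero in a Jacobson domain.
  have hmem : ∏ m, x m ∈ (⊥ : Ideal R).jacobson := by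
    rw [Ideal.jacobson, Ideal.mem_sInf]
    rintro I ⟨-, hI⟩
    exact Ideal.mem_of_dvd I (Finset.dvd_prod_of_mem x (Finset.mem_univ ⟨I, hI⟩))
      (hx ⟨I, hI⟩)
  rw [(isJacobsonRing_iff_prime_eq.1 inferInstance ⊥ Ideal.isPrime_bot), Ideal.mem_bot,
    Finset.prod_eq_zero_iff] at hmem
  obtain ⟨m, -, hm⟩ := hmem
  exact hx0 m hm

lemma MvPolynomial.not_isField {σ : Type u} [Nonempty σ] (k : Type v) [CommRing k] [IsDomain k] :
    ¬ IsField (MvPolynomial σ k) := by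
  intro h
  obtain ⟨i⟩ := ‹Nonempty σ›
  obtain ⟨p, hp⟩ := h.mul_inv_cancel (MvPolynomial.X_ne_zero (R := k) i)
  simpa using congr(MvPolynomial.constantCoeff $hp)

end

theorem mainTheorem9 (k : Type u) [Field k] (d : ℕ) :
    -- the complexes with finite length cohomology form a thick subcategory of `K^b(proj A)`
    IsThick (kbProjFiniteLength (MvPolynomial (Fin d) k)) ∧
    -- so do those supported at a given maximal ideal
    (∀ m : MaximalSpectrum (MvPolynomial (Fin d) k), IsThick (kbProjSupportedAt m)) ∧
    -- the former is the thick subcategory generated by the latter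
    IsLeast {Q : ObjectProperty (KbProj (MvPolynomial (Fin d) k)) | IsThick Q ∧
        ∀ m : MaximalSpectrum (MvPolynomial (Fin d) k), kbProjSupportedAt m ≤ Q}
      (kbProjFiniteLength (MvPolynomial (Fin d) k)) ∧
    -- and it is their direct sum
    IsTriangulatedDirectSum (kbProjFiniteLength (MvPolynomial (Fin d) k))
      (fun m : MaximalSpectrum (MvPolynomial (Fin d) k) => kbProjSupportedAt m) ∧
    -- the summands are connected (in particular nonzero) and pairwise distinct
    (∀ m : MaximalSpectrum (MvPolynomial (Fin d) k),
      IsConnectedTriangulated (kbProjSupportedAt m)) ∧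
    Function.Injective
      (fun m : MaximalSpectrum (MvPolynomial (Fin d) k) => kbProjSupportedAt m) ∧
    -- and there are infinitely many of them as soon as there is a variable
    (0 < d → Infinite (MaximalSpectrum (MvPolynomial (Fin d) k))) := by
  have hres (m : MaximalSpectrum (MvPolynomial (Fin d) k)) :
      ∃ P : KbProj (MvPolynomial (Fin d) k), P.IsResolution (ModuleCat.of _ (_ ⧸ m.asIdeal)) := by
    obtain ⟨rs, hrs, hm⟩ := maximalIdealsRegular_mvPolynomial k d m.asIdeal m.isMaximal
    exact KbProj.exists_isResolution_quotient hrs hm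
  refine ⟨?_, fun m => ?_, isLeast_kbProjFiniteLength hres,
    isTriangulatedDirectSum_kbProjFiniteLength hres,
    isConnectedTriangulated_kbProjSupportedAt hres, kbProjSupportedAt_injective hres, fun hd => ?_⟩
  · rw [kbProjFiniteLength_eq]
    exact isThick_kbCohomologyIn _
  · rw [kbProjSupportedAt_eq]
    exact isThick_kbCohomologyIn _
  · have : Nonempty (Fin d) := ⟨0, hd⟩
    exact infinite_maximalSpectrum (MvPolynomial.not_isField k)
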